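/- Let $X$ be a real Banach space with closed unit ball $\bar B$; equip $X\times\mathbb R$ with the norm $\|(v,r)\|=\max\{\|v\|,|r|\}$, and write $X^*$ for the topological dual of $X$. Definitions. Let $E$ be a Banach space with closed unit ball $\bar B_E$. (a) If $S\subset E$ is closed and $x_0\in S$, a bounded set $D\subset E$ is a *uniform tangent set* to $S$ at $x_0$ if for every $\varepsilon>0$ there is $\delta>0$ such that for every $v\in D$ and every $x\in S\cap(x_0+\delta\bar B_E)$ there is $\lambda>0$ with $S\cap\big(x+t(v+\varepsilon\bar B_E)\big)\neq\emptyset$ for all $t\in[0,\lambda]$. (b) A set $A\subset E$ is *quasisolid* if there is a point $y_0$ in the closed convex hull $\overline{\mathrm{co}}\,A$ such that $\overline{\mathrm{co}}(A-y_0)$ has nonempty interior relative to the closed linear span of $A-y_0$. (c) The epigraph of $\varphi:X\to\mathbb R\cup\{+\infty\}$ is $\mathrm{epi}\,\varphi=\{(x,p)\in X\times\mathbb R:\varphi(x)\le p\}$; $\varphi$ is *proper* if it is not identically $+\infty$. Theorem 3.3 (abstract Lagrange multiplier rule). Let $\varphi:X\to\mathbb R\cup\{+\infty\}$ be proper and lower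 semicontinuous, let $S\subset X$ be closed, and let $\bar x\in S$ satisfy $\varphi(\bar x)<+\infty$ and $\varphi(\bar x)\le\varphi(x)$ for all $x\in S$. Let $D_S\subset X$ be a uniform tangent set to $S$ at $\bar x$, put $D_{\tilde S}:=D_S\times[-1,0]\subset X\times\mathbb R$, and let $D_{\tilde R}\subset X\times\mathbb R$ be a uniform tangent set to $\tilde R:=\mathrm{epi}\,\varphi$ at $(\bar x,\varphi(\bar x))$. Assume that the set of differences $D_{\tilde S}-D_{\tilde R}=\{a-b: a\in D_{\tilde S},\ b\in D_{\tilde R}\}$ is quasisolid. Then there is a pair $(\xi,\eta)\in X^*\times\mathbb R$ such that (i) $(\xi,\eta)\neq(0,0)$; (ii) $\eta\in\{0,1\}$; (iii) $\langle\xi,v\rangle\le 0$ for every $v\in D_S$; (iv) $\langle\xi,w\rangle+\eta s\ge 0$ for every $(w,s)\in D_{\tilde R}$. -/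

import Mathlib

open scoped Pointwise

/-- A bounded set `D` is a uniform tangent set to `S` at `x₀` if for each `ε > 0` there is `δ > 0`
such that for all `v ∈ D` and all `x ∈ S ∩ (x₀ + δ B̄)` there is `r > 0` such that
`S ∩ (x + t (v + ε B̄))` is nonempty for each `t ∈ [0, r]`, where `B̄` is the closed unit ball. -/
def IsUniformTangentSet {E : Type*} [NormedAddCommGroup E] [NormedSpace ℝ E]
    (S : Set E) (x₀ : E) (D : Set E) : Prop :=
  Bornology.IsBounded D ∧
    ∀ ε : ℝ, 0 < ε → ∃ δ : ℝ, 0 < δ ∧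
      ∀ v ∈ D, ∀ x ∈ S ∩ Metric.closedBall x₀ δ, ∃ r : ℝ, 0 < r ∧
        ∀ t ∈ Set.Icc (0 : ℝ) r,
          (S ∩ (fun b : E => x + t • (v + ε • b)) '' Metric.closedBall (0 : E) 1).Nonempty

/-- The closed linear span of the translate `S - y₀`. -/
def closedSpanAt {E : Type*} [NormedAddCommGroup E] [NormedSpace ℝ E]
    (S : Set E) (y₀ : E) : Submodule ℝ E :=
  (Submodule.span ℝ ((fun z : E => z - y₀) '' S)).topologicalClosure

/-- A set `S` is quasisolid if there is a point `y₀` of its closed convex hull such that the closed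
convex hull of `S - y₀` has nonempty interior in the closed linear span of `S - y₀`
(the interior is taken in the subspace topology of that span). -/
def IsQuasisolid {E : Type*} [NormedAddCommGroup E] [NormedSpace ℝ E] (S : Set E) : Prop :=
  ∃ y₀ ∈ closedConvexHull ℝ S,
    (interior ((fun z : closedSpanAt S y₀ => (z : E)) ⁻¹'
      closedConvexHull ℝ ((fun z : E => z - y₀) '' S))).Nonempty

/-- The epigraph of an extended-real-valued function, as a subset of `E × ℝ`. -/
def epigraph {E : Type*} (φ : E → EReal) : Set (E × ℝ) :=
  {p | φ p.1 ≤ (p.2 : EReal)}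

/-- A function with values in `ℝ ∪ {+∞}` (never `-∞`) that is not identically `+∞`. -/
def IsProperFun {E : Type*} (φ : E → EReal) : Prop :=
  (∀ x, φ x ≠ ⊥) ∧ ∃ x, φ x ≠ ⊤

/-! Minimality means that `S ×ˢ Set.Iic c`, with `c` the minimal value, misses the epigraph after
any downward translation. Let `C` be the closure of the difference of the convex hulls of the two
tangent sets, with zero adjoined to `DS` and `DR`. Were `0` interior to `C`, the two sets would meet
after every small translation (`eventually_exists_add_eq`), so `0` is not interior to `C`. In
infinite dimension this alone does not give a nonzero separating functional; quasisolidity does.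
Either `C` has interior, and Hahn-Banach applies, or both tangent sets lie in a closed hyperplane
through the origin (`IsQuasisolid.interior_nonempty_or_exists_dual`). Dividing by the vertical
component, when positive, gives the multipliers. -/

/-- Ekeland's variational principle on a closed subset of a complete metric space. -/
theorem exists_ekeland_point {α : Type*} [MetricSpace α] [CompleteSpace α] {Z : Set α}
    (hZ : IsClosed Z) {f : α → ℝ} (hf : Continuous f) {m : ℝ} (hm : ∀ z ∈ Z, m ≤ f z)
    {c : ℝ} (hc : 0 < c) {z₀ : α} (hz₀ : z₀ ∈ Z) :
    ∃ z ∈ Z, f z + c * dist z z₀ ≤ f z₀ ∧ ∀ z' ∈ Z, z' ≠ z → f z < f z' + c * dist z' z := by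
  have trans : ∀ {a b d : α}, f b + c * dist b a ≤ f a → f d + c * dist d b ≤ f b →
      f d + c * dist d a ≤ f a := fun {a b d} h h' => by
    have := mul_le_mul_of_nonneg_left (dist_triangle d b a) hc.le
    linarith
  -- The near-minimiser `w` among the points dominated by `z` confines whatever `w` dominates to a
  -- ball of radius `(1 / 2) ^ n`.
  have step : ∀ (n : ℕ) (z : Z), ∃ w : Z, f w + c * dist w.1 z.1 ≤ f z ∧
      ∀ y ∈ Z, f y + c * dist y z.1 ≤ f z → f w ≤ f y + c * (1 / 2) ^ n := by
    intro n z
    let V := f '' {y | y ∈ Z ∧ f y + c * dist y z.1 ≤ f z}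
    have hV : V.Nonempty := ⟨f z, z, ⟨z.2, by simp⟩, rfl⟩
    have hb : BddBelow V := ⟨m, by rintro _ ⟨y, hy, rfl⟩; exact hm y hy.1⟩
    have hpos : 0 < c * (1 / 2) ^ n := by positivity
    obtain ⟨_, ⟨w, hw, rfl⟩, hlt⟩ := exists_lt_of_csInf_lt hV (lt_add_of_pos_right (sInf V) hpos)
    refine ⟨⟨w, hw.1⟩, hw.2, fun y hy hyz => ?_⟩
    have := csInf_le hb ⟨y, ⟨hy, hyz⟩, rfl⟩
    dsimp only
    linarith
  choose g hg hg' using step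
  let u : ℕ → Z := fun n => Nat.rec ⟨z₀, hz₀⟩ (fun n z => g n z) n
  have hu : ∀ n, u (n + 1) = g n (u n) := fun _ => rfl
  have hmono : ∀ n k, f (u (n + k)).1 + c * dist (u (n + k)).1 (u n).1 ≤ f (u n).1 := by
    intro n k
    induction k with
    | zero => simp
    | succ k ih => exact trans ih (hg (n + k) (u (n + k)))
  have hsmall : ∀ n, ∀ y ∈ Z, f y + c * dist y (u (n + 1)).1 ≤ f (u (n + 1)).1 →
      dist y (u (n + 1)).1 ≤ (1 / 2) ^ n := by
    intro n y hy h
    have h1 := hg' n (u n) y hy (trans (hg n (u n)) h)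
    rw [← hu] at h1
    exact le_of_mul_le_mul_left (by linarith) hc
  have hcauchy : CauchySeq fun n => (u (n + 1)).1 := by
    refine cauchySeq_of_le_geometric (1 / 2) 1 (by norm_num) fun n => ?_
    rw [dist_comm, one_mul]
    exact hsmall n _ (u (n + 1 + 1)).2 (hmono (n + 1) 1)
  obtain ⟨z, hz⟩ := cauchySeq_tendsto_of_complete hcauchy
  have hz' : Filter.Tendsto (fun n => (u n).1) Filter.atTop (nhds z) :=
    (Filter.tendsto_add_atTop_iff_nat 1).1 hz
  have hzZ : z ∈ Z := hZ.mem_of_tendsto hz' (Filter.Eventually.of_forall fun n => (u n).2)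
  have hzn : ∀ n, f z + c * dist z (u n).1 ≤ f (u n).1 := fun n => by
    have hcl : IsClosed {y | f y + c * dist y (u n).1 ≤ f (u n).1} :=
      isClosed_le (by fun_prop) continuous_const
    refine hcl.mem_of_tendsto hz' ?_
    filter_upwards [Filter.eventually_ge_atTop n] with k hk
    obtain ⟨j, rfl⟩ := Nat.exists_eq_add_of_le hk
    exact hmono n j
  refine ⟨z, hzZ, hzn 0, fun z' hz'Z hne => ?_⟩
  by_contra! hle
  refine hne (tendsto_nhds_unique ?_ hz)
  rw [tendsto_iff_dist_tendsto_zero]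
  refine squeeze_zero (fun _ => dist_nonneg) (fun n => ?_)
    (tendsto_pow_atTop_nhds_zero_of_lt_one (r := (1 / 2 : ℝ)) (by norm_num) (by norm_num))
  rw [dist_comm]
  exact hsmall n z' hz'Z (trans (hzn (n + 1)) hle)

/-! ### Uniform tangent sets and intersection under translation -/

section Reach

variable {E : Type*} [NormedAddCommGroup E] [NormedSpace ℝ E]

/-- If at every point of a closed set `S` near `x₀` arbitrarily small approximate steps in the
direction `v` are possible, then `S` can be followed approximately along `v` for a uniform time. -/
theorem exists_mem_norm_sub_le_of_local_step [CompleteSpace E] {S : Set E} (hS : IsClosed S)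
    {x₀ x v : E} {δ ε t : ℝ} (hε : 0 < ε)
    (hstep : ∀ y ∈ S, ‖y - x₀‖ ≤ δ → ∃ r : ℝ, 0 < r ∧ ∀ s ∈ Set.Icc (0 : ℝ) r,
      ∃ b : E, ‖b‖ ≤ 1 ∧ y + s • (v + ε • b) ∈ S)
    (hx : x ∈ S) (ht : 0 ≤ t) (hd : ‖x - x₀‖ + t * (‖v‖ + ε) ≤ δ) :
    ∃ y ∈ S, ‖y - x - t • v‖ ≤ ε * t := by
  -- Pairs of elapsed time and accumulated error in units of `ε`. Ekeland with constant 1 bounds the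
  -- error by the time.
  let Z : Set (ℝ × E) := {p | p.1 ∈ Set.Icc 0 t ∧ x + p.1 • v + ε • p.2 ∈ S}
  have hZ : IsClosed Z :=
    (isClosed_Icc.preimage continuous_fst).inter (hS.preimage (by fun_prop))
  have h0 : ((0 : ℝ), (0 : E)) ∈ Z := ⟨⟨le_rfl, ht⟩, by simpa using hx⟩
  obtain ⟨⟨s, u⟩, ⟨⟨hs0, hst⟩, hmem⟩, hle, hmin⟩ :=
    exists_ekeland_point hZ (f := fun p => -p.1) (by fun_prop) (m := -t)
      (fun z hz => neg_le_neg hz.1.2) one_pos h0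
  dsimp only at hs0 hst hmem hle hmin
  have hus : ‖u‖ ≤ s := by
    have h1 : ‖u‖ ≤ dist (s, u) ((0 : ℝ), (0 : E)) := by
      rw [Prod.dist_eq]; simp
    linarith
  rcases hst.eq_or_lt with rfl | hlt
  · refine ⟨_, hmem, ?_⟩
    rw [show x + s • v + ε • u - x - s • v = ε • u by abel, norm_smul, Real.norm_of_nonneg hε.le]
    gcongr
  -- A further step of length `h` gains time `h` at distance at most `h`, contradicting strict
  -- minimality.
  · exfalso
    have hnear : ‖x + s • v + ε • u - x₀‖ ≤ δ := by
      calc ‖x + s • v + ε • u - x₀‖ = ‖(x - x₀) + (s • v + ε • u)‖ := by congr 1; abel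
        _ ≤ ‖x - x₀‖ + (‖s • v‖ + ‖ε • u‖) :=
          (norm_add_le _ _).trans (by gcongr; exact norm_add_le _ _)
        _ = ‖x - x₀‖ + (s * ‖v‖ + ε * ‖u‖) := by
          rw [norm_smul, norm_smul, Real.norm_of_nonneg hε.le, Real.norm_of_nonneg hs0]
        _ ≤ ‖x - x₀‖ + (t * ‖v‖ + ε * t) := by gcongr; linarith
        _ ≤ δ := by linarith
    obtain ⟨r, hr, hrs⟩ := hstep _ hmem hnear
    have hh : 0 < min r (t - s) := lt_min hr (by linarith)
    obtain ⟨b, hb, hb'⟩ := hrs (min r (t - s)) ⟨hh.le, min_le_left _ _⟩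
    set h := min r (t - s)
    have hht : h ≤ t - s := min_le_right _ _
    have hmem' : (s + h, u + h • b) ∈ Z := by
      refine ⟨⟨by dsimp only; linarith, by dsimp only; linarith⟩, ?_⟩
      convert hb' using 1
      module
    have := hmin _ hmem' (fun he => by have := congrArg Prod.fst he; dsimp only at this; linarith)
    have hdist : dist (s + h, u + h • b) (s, u) ≤ h := by
      rw [Prod.dist_eq, max_le_iff]
      constructor
      · simp [abs_of_pos hh]
      · rw [dist_eq_norm, add_sub_cancel_left, norm_smul, Real.norm_of_nonneg hh.le]
        nlinarith
    dsimp only at this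
    linarith

namespace IsUniformTangentSet

/-- Standing still realises the direction zero. Adjoining it puts each tangent set, up to sign,
inside the set of differences. -/
theorem insert_zero {S D : Set E} {x₀ : E} (hD : IsUniformTangentSet S x₀ D) :
    IsUniformTangentSet S x₀ (insert 0 D) := by
  refine ⟨hD.1.insert 0, fun ε hε => ?_⟩
  obtain ⟨δ, hδ, h⟩ := hD.2 ε hε
  refine ⟨δ, hδ, ?_⟩
  rintro v (rfl | hv) x hx
  · exact ⟨1, one_pos, fun t _ => ⟨x, hx.1, 0, by simp, by simp⟩⟩
  · exact h v hv x hx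

/-- Directions `v` of a uniform tangent set may be replaced by convex combinations, and the step
length is uniform. -/
theorem exists_forall_mem_convexHull [CompleteSpace E] {S D : Set E} {x₀ : E}
    (hD : IsUniformTangentSet S x₀ D) (hS : IsClosed S) {ε : ℝ} (hε : 0 < ε) :
    ∃ δ > 0, ∃ K > 0, ∀ v ∈ convexHull ℝ D, ∀ x ∈ S, ∀ t ≥ 0, ‖x - x₀‖ + t * K ≤ δ →
      ∃ y ∈ S, ‖y - x - t • v‖ ≤ ε * t ∧ ‖y - x‖ ≤ K * t := by
  obtain ⟨M, hM, hDM⟩ := hD.1.exists_pos_norm_le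
  obtain ⟨δ, hδ, h⟩ := hD.2 ε hε
  let Q : Set E := {v | ‖v‖ ≤ M ∧ ∀ x ∈ S, ∀ t ≥ 0, ‖x - x₀‖ + t * (M + ε) ≤ δ →
    ∃ y ∈ S, ‖y - x - t • v‖ ≤ ε * t}
  have hle : ∀ {v x y : E} {t : ℝ}, ‖v‖ ≤ M → 0 ≤ t → ‖y - x - t • v‖ ≤ ε * t →
      ‖y - x‖ ≤ (M + ε) * t := fun {v x y t} hv ht hy => by
    have h1 := norm_add_le (y - x - t • v) (t • v)
    rw [sub_add_cancel, norm_smul, Real.norm_of_nonneg ht] at h1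
    nlinarith
  have hDQ : D ⊆ Q := by
    refine fun v hv => ⟨hDM v hv, fun x hx t ht hd => ?_⟩
    refine exists_mem_norm_sub_le_of_local_step hS hε (fun y hy hyd => ?_) hx ht
      (hd.trans' (by gcongr; exact hDM v hv))
    obtain ⟨r, hr, hrs⟩ := h v hv y ⟨hy, by simpa [dist_eq_norm] using hyd⟩
    refine ⟨r, hr, fun s hs => ?_⟩
    obtain ⟨_, hz, b, hb, rfl⟩ := hrs s hs
    exact ⟨b, by simpa using hb, hz⟩
  have hQ : Convex ℝ Q := by
    rintro v ⟨hvM, hv⟩ w ⟨hwM, hw⟩ a b ha hb hab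
    refine ⟨?_, fun x hx t ht hd => ?_⟩
    · have := convex_closedBall (0 : E) M (x := v) (by simpa using hvM) (y := w)
        (by simpa using hwM) ha hb hab
      simpa using this
    -- Follow `v` for time `a * t`, then `w` for time `b * t`; the speed bound `M + ε` keeps the
    -- path in the ball.
    · have hsum : t = a * t + b * t := by rw [← add_mul, hab, one_mul]
      have hat : 0 ≤ a * t := mul_nonneg ha ht
      have hbt : 0 ≤ b * t := mul_nonneg hb ht
      have hMε : 0 < M + ε := by positivity
      obtain ⟨y, hyS, hy⟩ := hv x hx (a * t) hat (hd.trans' (by gcongr; linarith))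
      have hyx := hle hvM hat hy
      obtain ⟨z, hzS, hz⟩ := hw y hyS (b * t) hbt (by
        have := norm_sub_le_norm_sub_add_norm_sub y x x₀
        have h3 : t * (M + ε) = (M + ε) * (a * t) + b * t * (M + ε) := by
          linear_combination (M + ε) * hsum
        linarith)
      refine ⟨z, hzS, ?_⟩
      calc ‖z - x - t • (a • v + b • w)‖
          = ‖(z - y - (b * t) • w) + (y - x - (a * t) • v)‖ := by congr 1; module
        _ ≤ ε * (b * t) + ε * (a * t) := (norm_add_le _ _).trans (add_le_add hz hy)
        _ = ε * t := by linear_combination -ε * hsum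
  refine ⟨δ, hδ, M + ε, by positivity, fun v hv x hx t ht hd => ?_⟩
  obtain ⟨hvM, hv'⟩ := convexHull_min hDQ hQ hv
  obtain ⟨y, hy, hyt⟩ := hv' x hx t ht hd
  exact ⟨y, hy, hyt, hle hvM ht hyt⟩

end IsUniformTangentSet

/-- If the closed convex hulls of two uniform tangent sets have differences covering a
neighbourhood of zero, then the sets still meet after a small translation. -/
theorem eventually_exists_add_eq [CompleteSpace E] {A B DA DB : Set E} {x₀ : E}
    (hA : IsClosed A) (hB : IsClosed B) (hxA : x₀ ∈ A) (hxB : x₀ ∈ B)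
    (hDA : IsUniformTangentSet A x₀ DA) (hDB : IsUniformTangentSet B x₀ DB)
    (h0 : (0 : E) ∈ interior (closure (convexHull ℝ DA - convexHull ℝ DB))) :
    ∀ᶠ z in nhds (0 : E), ∃ a ∈ A, ∃ b ∈ B, a + z = b := by
  obtain ⟨r, hr, hball⟩ := Metric.nhds_basis_closedBall.mem_iff.1 (mem_interior_iff_mem_nhds.1 h0)
  -- Three errors of rate `r / 6` spend half of the decrease rate `r`; the Ekeland penalty, of rate
  -- `c * K = r / 2`, spends the other half.
  have hε : 0 < r / 6 := by positivity
  obtain ⟨δ₁, hδ₁, K₁, hK₁, hA'⟩ := hDA.exists_forall_mem_convexHull hA hε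
  obtain ⟨δ₂, hδ₂, K₂, hK₂, hB'⟩ := hDB.exists_forall_mem_convexHull hB hε
  set K := K₁ + K₂
  have hK : 0 < K := by positivity
  set δ := min δ₁ δ₂
  have hδ : 0 < δ := lt_min hδ₁ hδ₂
  set c := r / 2 / K
  have hc : 0 < c := by positivity
  have hcK : c * K = r / 2 := div_mul_cancel₀ _ hK.ne'
  filter_upwards [Metric.ball_mem_nhds (0 : E) (show 0 < c * (δ / 2) by positivity)] with z hz
  rw [mem_ball_zero_iff] at hz
  obtain ⟨⟨a, b⟩, ⟨haA, hbB⟩, hle, hmin⟩ :=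
    exists_ekeland_point (hA.prod hB) (f := fun p : E × E => ‖p.1 + z - p.2‖) (by fun_prop)
      (m := 0) (fun _ _ => norm_nonneg _) hc (z₀ := (x₀, x₀)) ⟨hxA, hxB⟩
  dsimp only at haA hbB hle hmin
  refine ⟨a, haA, b, hbB, ?_⟩
  by_contra hne
  set d := ‖a + z - b‖
  have hdpos : 0 < d := norm_pos_iff.2 (sub_ne_zero.2 hne)
  have hdist : dist (a, b) (x₀, x₀) ≤ δ / 2 := by
    rw [add_sub_cancel_left] at hle
    exact le_of_mul_le_mul_left (by linarith) hc
  rw [Prod.dist_eq, max_le_iff, dist_eq_norm, dist_eq_norm] at hdist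
  -- Direction of norm `r` along which the gap closes fastest.
  have hu : -((r / d) • (a + z - b)) ∈ closure (convexHull ℝ DA - convexHull ℝ DB) := by
    refine hball ?_
    rw [mem_closedBall_zero_iff, norm_neg, norm_smul, Real.norm_of_nonneg (by positivity)]
    exact (div_mul_cancel₀ _ hdpos.ne').le
  obtain ⟨_, ⟨v, hv, w, hw, rfl⟩, hvw⟩ := Metric.mem_closure_iff.1 hu _ hε
  -- The first bound avoids overshooting the gap, the second stays within `δ` of `x₀`.
  set t := min (d / r) (δ / 2 / K)
  have ht : 0 < t := lt_min (by positivity) (by positivity)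
  have htd : t * r ≤ d := (le_div_iff₀ hr).1 (min_le_left _ _)
  have htK : t * K ≤ δ / 2 := (le_div_iff₀ hK).1 (min_le_right _ _)
  have htK₁ : t * K₁ ≤ t * K := by gcongr; linarith
  have htK₂ : t * K₂ ≤ t * K := by gcongr; linarith
  obtain ⟨a', ha', ha₁, ha₂⟩ := hA' v hv a haA t ht.le (by linarith [min_le_left δ₁ δ₂])
  obtain ⟨b', hb', hb₁, hb₂⟩ := hB' w hw b hbB t ht.le (by linarith [min_le_right δ₁ δ₂])
  have hF : ‖a' + z - b'‖ ≤ d - t * r + t * (r / 2) := by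
    calc ‖a' + z - b'‖ = ‖(1 - t * r / d) • (a + z - b) + (a' - a - t • v) - (b' - b - t • w)
            - t • (-((r / d) • (a + z - b)) - (v - w))‖ := by
          congr 1
          rw [show t * r / d = t * (r / d) by ring]
          module
      _ ≤ (1 - t * r / d) * d + r / 6 * t + r / 6 * t + t * (r / 6) := by
          refine (norm_sub_le _ _).trans (add_le_add ((norm_sub_le _ _).trans
            (add_le_add ((norm_add_le _ _).trans (add_le_add ?_ ha₁)) hb₁)) ?_)
          · rw [norm_smul, Real.norm_of_nonneg]
            rw [sub_nonneg, div_le_one hdpos]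
            exact htd
          · rw [norm_smul, Real.norm_of_nonneg ht.le, ← dist_eq_norm]
            gcongr
      _ = d - t * r + t * (r / 2) := by field_simp; ring
  have htr : 0 < t * r := by positivity
  have hmin' := hmin (a', b') ⟨ha', hb'⟩ (fun he => by
    rw [Prod.mk.injEq] at he
    rw [he.1, he.2] at hF
    linarith)
  have hd' : dist (a', b') (a, b) ≤ K * t := by
    rw [Prod.dist_eq, max_le_iff, dist_eq_norm, dist_eq_norm]
    exact ⟨by linarith, by linarith⟩
  have : c * dist (a', b') (a, b) ≤ t * (r / 2) := by
    calc c * dist (a', b') (a, b) ≤ c * (K * t) := by gcongr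
      _ = t * (r / 2) := by rw [← mul_assoc, hcK, mul_comm]
  dsimp only at hmin'
  linarith

end Reach

/-! ### Quasisolid sets and separation -/

section Separation

variable {E : Type*} [NormedAddCommGroup E] [NormedSpace ℝ E]

/-- A proper closed subspace is annihilated by a nonzero continuous linear functional. -/
theorem Submodule.exists_dual_ne_zero_of_isClosed {M : Submodule ℝ E}
    (hM : IsClosed (M : Set E)) (hne : M ≠ ⊤) :
    ∃ f : StrongDual ℝ E, f ≠ 0 ∧ ∀ x ∈ M, f x = 0 := by
  obtain ⟨x, hx⟩ : ∃ x, x ∉ M := by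
    by_contra! h
    exact hne (Submodule.eq_top_iff'.2 h)
  obtain ⟨f, u, hf, hu⟩ := geometric_hahn_banach_closed_point M.convex hM hx
  have hu0 : 0 < u := by simpa using hf 0 M.zero_mem
  refine ⟨f, ?_, fun y hy => ?_⟩
  · rintro rfl
    exact absurd hu (not_lt.2 (by simpa using hu0.le))
  · by_contra hne
    have := hf ((u / f y) • y) (M.smul_mem _ hy)
    rw [map_smul, smul_eq_mul, div_mul_cancel₀ _ hne] at this
    exact lt_irrefl _ this

theorem IsQuasisolid.nonempty {A : Set E} (h : IsQuasisolid A) : A.Nonempty := by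
  obtain ⟨y₀, hy₀, -⟩ := h
  rw [closedConvexHull_eq_closure_convexHull] at hy₀
  exact convexHull_nonempty_iff.1 (closure_nonempty_iff.1 ⟨y₀, hy₀⟩)

/-- A closed convex set containing `0`, `P`, `-Q` and `P - Q`, where `P - Q` is quasisolid, either
is solid or is contained in a closed hyperplane through the origin. -/
theorem IsQuasisolid.interior_nonempty_or_exists_dual [CompleteSpace E] {P Q C : Set E}
    (h : IsQuasisolid (P - Q)) (hC : Convex ℝ C) (hCc : IsClosed C) (h0 : (0 : E) ∈ C)
    (hP : P ⊆ C) (hQ : ∀ q ∈ Q, -q ∈ C) (hPQ : P - Q ⊆ C) :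
    (interior C).Nonempty ∨
      ∃ f : StrongDual ℝ E, f ≠ 0 ∧ (∀ p ∈ P, f p = 0) ∧ ∀ q ∈ Q, f q = 0 := by
  obtain ⟨_, p₀, hp₀, q₀, hq₀, -⟩ := h.nonempty
  obtain ⟨y₀, -, hw⟩ := h
  set L := closedSpanAt (P - Q) y₀
  obtain ⟨w₀, hw₀⟩ := hw
  have hL : IsClosed (L : Set E) := Submodule.isClosed_topologicalClosure _
  have hmemL : ∀ a ∈ P - Q, a - y₀ ∈ L := fun a ha =>
    Submodule.le_topologicalClosure _ (Submodule.subset_span ⟨a, ha, rfl⟩)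
  have hsubL : ∀ a ∈ P - Q, ∀ b ∈ P - Q, a - b ∈ L := fun a ha b hb => by
    simpa using L.sub_mem (hmemL a ha) (hmemL b hb)
  have hspan : FiniteDimensional ℝ (Submodule.span ℝ {p₀, q₀}) :=
    FiniteDimensional.span_of_finite ℝ (Set.toFinite _)
  -- `L` holds only differences of points of `P` and of `Q`; adding `p₀` and `q₀` captures the
  -- points themselves.
  set M := L ⊔ Submodule.span ℝ {p₀, q₀}
  have hM : IsClosed (M : Set E) := Submodule.isClosed_sup_finiteDimensional _ _ hL
  have hp₀M : p₀ ∈ M := Submodule.mem_sup_right (Submodule.subset_span (by simp))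
  have hq₀M : q₀ ∈ M := Submodule.mem_sup_right (Submodule.subset_span (by simp))
  by_cases hMtop : M = ⊤
  · left
    have hcomplete : CompleteSpace L := hL.completeSpace_coe
    let Φ : (L × ℝ × ℝ) →L[ℝ] E :=
      (1 / 2 : ℝ) • L.subtypeL.comp (ContinuousLinearMap.fst ℝ L (ℝ × ℝ)) +
      ((ContinuousLinearMap.fst ℝ ℝ ℝ).comp (ContinuousLinearMap.snd ℝ L (ℝ × ℝ))).smulRight p₀ -
      ((ContinuousLinearMap.snd ℝ ℝ ℝ).comp (ContinuousLinearMap.snd ℝ L (ℝ × ℝ))).smulRight q₀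
    have hΦ : ∀ l b c, Φ (l, b, c) = (1 / 2 : ℝ) • (l : E) + b • p₀ - c • q₀ := fun _ _ _ => rfl
    have hsurj : Function.Surjective Φ := by
      intro x
      have hx : x ∈ M := hMtop ▸ Submodule.mem_top
      obtain ⟨l, hl, z, hz, rfl⟩ := Submodule.mem_sup.1 hx
      obtain ⟨b, c, rfl⟩ := Submodule.mem_span_pair.1 hz
      refine ⟨((2 : ℝ) • ⟨l, hl⟩, b, -c), ?_⟩
      rw [hΦ]
      simp only [Submodule.coe_smul]
      module
    let V : Set (L × ℝ × ℝ) := interior ((fun z : L => (z : E)) ⁻¹'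
      closedConvexHull ℝ ((fun z : E => z - y₀) '' (P - Q))) ×ˢ
        (Set.Ioo (0 : ℝ) (1 / 4) ×ˢ Set.Ioo (0 : ℝ) (1 / 4))
    have hV : IsOpen V := isOpen_interior.prod (isOpen_Ioo.prod isOpen_Ioo)
    have hopen : IsOpen ((fun x => (1 / 2 : ℝ) • y₀ + x) '' (Φ '' V)) :=
      isOpenMap_add_left _ _ (Φ.isOpenMap hsurj _ hV)
    have hhull : closedConvexHull ℝ ((fun z : E => z - y₀) '' (P - Q)) ⊆
        (fun x => y₀ + x) ⁻¹' C := by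
      refine closedConvexHull_min ?_ (hC.translate_preimage_right y₀)
        (hCc.preimage (by fun_prop))
      rintro _ ⟨a, ha, rfl⟩
      simpa using hPQ ha
    refine ⟨(1 / 2 : ℝ) • y₀ + Φ (w₀, 1 / 8, 1 / 8), mem_interior.2 ⟨_, ?_, hopen,
      Set.mem_image_of_mem _ (Set.mem_image_of_mem _ ⟨hw₀, by norm_num, by norm_num⟩)⟩⟩
    rintro _ ⟨_, ⟨⟨l, b, c⟩, ⟨hl, ⟨hb0, hb⟩, ⟨hc0, hc⟩⟩, rfl⟩, rfl⟩
    have hl' : y₀ + (l : E) ∈ C := by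
      have : l ∈ (fun z : L => (z : E)) ⁻¹' _ := interior_subset hl
      exact hhull this
    dsimp only at hb0 hb hc0 hc
    -- With `b, c < 1 / 4`, the point is a convex combination: weight 1/2 on `y₀ + l`, and 1/4 each
    -- on `(4 * b) • p₀` and `-(4 * c) • q₀`.
    have h1 := hC h0 (hQ q₀ hq₀) (show 0 ≤ 1 - 4 * c by linarith) (show 0 ≤ 4 * c by linarith)
      (by ring)
    have h2 := hC h0 (hP hp₀) (show 0 ≤ 1 - 4 * b by linarith) (show 0 ≤ 4 * b by linarith)
      (by ring)
    have h3 := hC h1 h2 (show (0 : ℝ) ≤ 1 / 2 by norm_num) (show (0 : ℝ) ≤ 1 / 2 by norm_num)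
      (by norm_num)
    have h4 := hC hl' h3 (show (0 : ℝ) ≤ 1 / 2 by norm_num) (show (0 : ℝ) ≤ 1 / 2 by norm_num)
      (by norm_num)
    convert h4 using 1
    dsimp only
    rw [hΦ]
    module
  · right
    obtain ⟨f, hf, hfM⟩ := Submodule.exists_dual_ne_zero_of_isClosed hM hMtop
    refine ⟨f, hf, fun p hp => hfM p ?_, fun q hq => hfM q ?_⟩
    · have h1 : p - p₀ ∈ L := by
        simpa using hsubL _ (Set.sub_mem_sub hp hq₀) _ (Set.sub_mem_sub hp₀ hq₀)
      simpa using M.add_mem (Submodule.mem_sup_left h1) hp₀M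
    · have h1 : q - q₀ ∈ L := by
        simpa using hsubL _ (Set.sub_mem_sub hp₀ hq₀) _ (Set.sub_mem_sub hp₀ hq)
      simpa using M.add_mem (Submodule.mem_sup_left h1) hq₀M

end Separation

/-! ### The multiplier rule -/

/-- Multiplying `S` by a ray bounded above keeps uniform tangency along nonpositive heights. -/
theorem IsUniformTangentSet.prod_Iic {X : Type*} [NormedAddCommGroup X] [NormedSpace ℝ X]
    {S D : Set X} {x₀ : X} (hD : IsUniformTangentSet S x₀ D) (c : ℝ) :
    IsUniformTangentSet (S ×ˢ Set.Iic c) (x₀, c) (D ×ˢ Set.Icc (-1 : ℝ) 0) := by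
  refine ⟨hD.1.prod (Metric.isBounded_Icc _ _), fun ε hε => ?_⟩
  obtain ⟨δ, hδ, h⟩ := hD.2 ε hε
  refine ⟨δ, hδ, ?_⟩
  rintro ⟨v, s⟩ ⟨hv, hs⟩ ⟨x, r⟩ ⟨⟨hx, hr⟩, hd⟩
  rw [Metric.mem_closedBall, Prod.dist_eq, max_le_iff] at hd
  obtain ⟨l, hl, hl'⟩ := h v hv x ⟨hx, hd.1⟩
  refine ⟨l, hl, fun t ht => ?_⟩
  obtain ⟨_, hz, b, hb, rfl⟩ := hl' t ht
  refine ⟨(x + t • (v + ε • b), r + t * s), ⟨hz, ?_⟩, (b, 0), ?_, ?_⟩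
  · exact (add_le_of_nonpos_right (mul_nonpos_of_nonneg_of_nonpos ht.1 hs.2)).trans hr
  · rw [mem_closedBall_zero_iff] at hb ⊢
    simpa [Prod.norm_def] using hb
  · simp

theorem LowerSemicontinuous.isClosed_epigraph_real {X : Type*} [TopologicalSpace X]
    {φ : X → EReal} (hφ : LowerSemicontinuous φ) : IsClosed (epigraph φ) :=
  hφ.isClosed_epigraph.preimage
    (continuous_fst.prodMk (continuous_coe_real_ereal.comp continuous_snd))

theorem theorem3p3 {X : Type*} [NormedAddCommGroup X] [NormedSpace ℝ X] [CompleteSpace X]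
    (φ : X → EReal) (hφ_lsc : LowerSemicontinuous φ) (hφ_proper : IsProperFun φ)
    (S : Set X) (hS : IsClosed S)
    (xbar : X) (hxS : xbar ∈ S) (hmin : IsMinOn φ S xbar) (hfin : φ xbar ≠ ⊤)
    (DS : Set X) (hDS : IsUniformTangentSet S xbar DS)
    (DR : Set (X × ℝ))
    (hDR : IsUniformTangentSet (epigraph φ) (xbar, (φ xbar).toReal) DR)
    (hquasi : IsQuasisolid ((DS ×ˢ Set.Icc (-1 : ℝ) 0) - DR)) :
    ∃ (ξ : StrongDual ℝ X) (η : ℝ),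
      (ξ, η) ≠ (0, 0) ∧
      (η = 0 ∨ η = 1) ∧
      (∀ v ∈ DS, ξ v ≤ 0) ∧
      (∀ p ∈ DR, 0 ≤ ξ p.1 + η * p.2) := by
  have hc : φ xbar = ((φ xbar).toReal : EReal) := (EReal.coe_toReal hfin (hφ_proper.1 xbar)).symm
  set c := (φ xbar).toReal
  set P := (insert 0 DS) ×ˢ Set.Icc (-1 : ℝ) 0
  set Q := insert 0 DR
  set C := closure (convexHull ℝ P - convexHull ℝ Q)
  have hC : Convex ℝ C := ((convex_convexHull ℝ P).sub (convex_convexHull ℝ Q)).closure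
  have hmem : ∀ p ∈ P, ∀ q ∈ Q, p - q ∈ C := fun p hp q hq =>
    subset_closure (Set.sub_mem_sub (subset_convexHull ℝ P hp) (subset_convexHull ℝ Q hq))
  have hP0 : (0 : X × ℝ) ∈ P := ⟨by simp, by simp⟩
  have hP1 : ((0 : X), (-1 : ℝ)) ∈ P := ⟨by simp, by simp⟩
  have hQ0 : (0 : X × ℝ) ∈ Q := Set.mem_insert _ _
  have hDP : DS ×ˢ Set.Icc (-1 : ℝ) 0 ⊆ P := Set.prod_mono_left (Set.subset_insert _ _)
  have hDQ : DR ⊆ Q := Set.subset_insert _ _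
  have hint : (0 : X × ℝ) ∉ interior C := by
    intro h0
    have hev := eventually_exists_add_eq (hS.prod isClosed_Iic) hφ_lsc.isClosed_epigraph_real
      (x₀ := (xbar, c)) ⟨hxS, le_refl c⟩ hc.le (hDS.insert_zero.prod_Iic c) hDR.insert_zero h0
    obtain ⟨ε, hε, hball⟩ := Metric.eventually_nhds_iff.1 hev
    -- Translating down by `ε / 2` would produce a point of `S` with value below the minimum.
    obtain ⟨⟨x, r⟩, ⟨hx, hr⟩, ⟨y, s⟩, hy, heq⟩ :=
      hball (y := (0, -(ε / 2))) (by simp [Prod.norm_def, abs_of_pos hε, hε])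
    simp only [Prod.mk_add_mk, add_zero, Prod.mk.injEq] at heq
    obtain ⟨rfl, rfl⟩ := heq
    have h1 : (c : EReal) ≤ ((r + -(ε / 2) : ℝ) : EReal) := hc ▸ (hmin hx).trans hy
    have h2 : c ≤ r + -(ε / 2) := EReal.coe_le_coe_iff.1 h1
    have h3 : r ≤ c := hr
    linarith
  obtain ⟨f, hf0, hfη, hfS, hfR⟩ : ∃ f : StrongDual ℝ (X × ℝ), f ≠ 0 ∧ 0 ≤ f (0, 1) ∧
      (∀ v ∈ DS, f (v, 0) ≤ 0) ∧ ∀ q ∈ DR, 0 ≤ f q := by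
    rcases hquasi.interior_nonempty_or_exists_dual hC isClosed_closure
      (by simpa using hmem 0 hP0 0 hQ0) (fun p hp => by simpa using hmem p (hDP hp) 0 hQ0)
      (fun q hq => by simpa using hmem 0 hP0 q (hDQ hq))
      (by rintro _ ⟨p, hp, q, hq, rfl⟩; exact hmem p (hDP hp) q (hDQ hq)) with hne | ⟨f, hf, hfP, hfQ⟩
    · obtain ⟨f, hf, hfC⟩ := geometric_hahn_banach_of_nonempty_interior_point hC hint hne
      simp only [map_zero] at hfC
      refine ⟨f, hf, ?_, fun v hv => ?_, fun q hq => ?_⟩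
      · have h1 := hfC _ (hmem _ hP1 0 hQ0)
        rw [sub_zero, show ((0 : X), (-1 : ℝ)) = -(0, 1) by simp, map_neg] at h1
        exact neg_nonpos.1 h1
      · simpa using hfC _ (hmem (v, 0) (hDP ⟨hv, by simp⟩) 0 hQ0)
      · simpa using hfC _ (hmem 0 hP0 q (hDQ hq))
    · refine ⟨f, hf, ?_, fun v hv => (hfP _ ⟨hv, by simp⟩).le, fun q hq => (hfQ q hq).ge⟩
      -- Vanishing at both heights `0` and `-1` over one `v` forces `f (0, 1) = 0`.
      obtain ⟨_, ⟨v, s⟩, ⟨hv, -⟩, -⟩ := hquasi.nonempty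
      have h1 := hfP (v, 0) ⟨hv, by simp⟩
      have h2 := hfP (v, -1) ⟨hv, by simp⟩
      have h3 := map_sub f (v, 0) (v, -1)
      rw [h1, h2] at h3
      simpa using h3.ge
  have hf : ∀ (x : X) (r : ℝ), f (x, r) = f (x, 0) + f (0, 1) * r := fun x r => by
    rw [mul_comm, ← smul_eq_mul, ← map_smul, ← map_add]
    simp
  let ξ : StrongDual ℝ X := f.comp (ContinuousLinearMap.inl ℝ X ℝ)
  have hξ : ∀ x, ξ x = f (x, 0) := fun _ => rfl
  rcases hfη.eq_or_lt with hη | hη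
  · refine ⟨ξ, 0, fun h => hf0 ?_, Or.inl rfl, hfS, fun q hq => ?_⟩
    · have hξ0 : ξ = 0 := congrArg Prod.fst h
      ext x
      · exact DFunLike.congr_fun hξ0 x
      · simpa using hη.symm
    · have h1 := hfR q hq
      rwa [show q = (q.1, q.2) from rfl, hf q.1, ← hη] at h1
  · refine ⟨(f (0, 1))⁻¹ • ξ, 1, by simp, Or.inr rfl, fun v hv => ?_, fun q hq => ?_⟩
    · exact mul_nonpos_of_nonneg_of_nonpos (inv_nonneg.2 hfη) (hfS v hv)
    · have h1 := mul_nonneg (inv_nonneg.2 hfη) (hfR q hq)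
      rw [show q = (q.1, q.2) from rfl, hf q.1, mul_add, ← mul_assoc, inv_mul_cancel₀ hη.ne'] at h1
      exact h1
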